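/- Let $S$ be a set of $n=2m+1$ points in convex position in the plane ($m\ge 0$). An odd matching on $S$ is a set of pairwise non-crossing straight-line segments with pairwise distinct endpoints in $S$ that covers all points of $S$ but exactly one. The flip graph of $S$ has the odd matchings on $S$ as its vertices, two of them being adjacent if one arises from the other by removing one edge and inserting a different one. Let $d(M,M')$ denote the distance in this graph. Then the radius $\min_M\max_{M'} d(M,M')$ of the flip graph is finite and at most $\frac{3m}{2}$ (that is, at most $\frac{3m}{2}-\mathcal{O}(1)$, where the $\mathcal O(1)$ term is a non-negative quantity that may be taken to be $0$). As a consequence, the diameter $\max_{M,M'} d(M,M')$ of the flip graph is finite and at most $3m=\frac{3n}{2}-\frac32=\frac{3n}{2}-\mathcal{O}(1)$. -/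

import Mathlib

/-- The Euclidean plane. -/
abbrev Plane : Type := EuclideanSpace ℝ (Fin 2)

/-- A finite set of points in the plane is in convex position if each of its points is outside
the convex hull of the other ones. -/
def InConvexPosition (S : Finset Plane) : Prop :=
  ConvexIndependent ℝ (fun p : S => (p : Plane))

/-- The straight line segment spanned by an unordered pair of points. -/
def edgeSegment (e : Sym2 Plane) : Set Plane :=
  convexHull ℝ {p : Plane | p ∈ e}

/-- `M` is a matching on the point set `S`: a set of edges, each joining two distinct points of
`S`, no two of which share an endpoint. -/
structure IsPointMatching (S : Finset Plane) (M : Set (Sym2 Plane)) : Prop where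
  not_isDiag : ∀ e ∈ M, ¬ e.IsDiag
  mem_of_mem : ∀ e ∈ M, ∀ p ∈ e, p ∈ S
  disjoint_endpoints : ∀ e ∈ M, ∀ f ∈ M, e ≠ f → ∀ p ∈ e, p ∉ f

/-- A matching is plane if no two of its edges cross, that is, the segments of any two distinct
edges (which have no endpoint in common) do not meet. -/
def IsPlaneMatching (M : Set (Sym2 Plane)) : Prop :=
  ∀ e ∈ M, ∀ f ∈ M, e ≠ f → Disjoint (edgeSegment e) (edgeSegment f)

/-- An odd matching on `S`: a plane matching on `S` for which exactly one point of `S` (the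
isolated one) is not an endpoint of any edge. -/
structure IsOddMatching (S : Finset Plane) (M : Set (Sym2 Plane)) : Prop where
  matching : IsPointMatching S M
  plane : IsPlaneMatching M
  isolated : ∃! p : Plane, p ∈ S ∧ ∀ e ∈ M, p ∉ e

/-- The odd matchings on the point set `S`. -/
def OddMatching (S : Finset Plane) : Type :=
  {M : Set (Sym2 Plane) // IsOddMatching S M}

/-- `M'` arises from `M` by removing one edge and inserting a different one. -/
def IsFlip (M M' : Set (Sym2 Plane)) : Prop :=
  ∃ e ∈ M, ∃ f, f ∉ M ∧ M' = insert f (M \ {e})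

theorem IsFlip.symm {M M' : Set (Sym2 Plane)} (h : IsFlip M M') : IsFlip M' M := by
  obtain ⟨e, he, f, hf, rfl⟩ := h
  have hef : e ≠ f := fun h => hf (h ▸ he)
  refine ⟨f, Set.mem_insert _ _, e, ?_, ?_⟩
  · simp [hef]
  · ext x
    by_cases hx : x = e
    · subst hx; simp [he]
    · by_cases hxf : x = f
      · subst hxf; simp [hx, hf]
      · simp [hx, hxf]

theorem IsFlip.irrefl (M : Set (Sym2 Plane)) : ¬ IsFlip M M := by
  rintro ⟨e, _, f, hf, h⟩
  exact hf (h ▸ Set.mem_insert _ _)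

/-- The flip graph of the point set `S`: its vertices are the odd matchings on `S`, and two of
them are adjacent if they differ in a single flip. -/
def flipGraph (S : Finset Plane) : SimpleGraph (OddMatching S) where
  Adj M M' := IsFlip M.1 M'.1
  symm := ⟨fun _ _ h => IsFlip.symm h⟩
  loopless := ⟨fun M h => IsFlip.irrefl M.1 h⟩

/-! Label the points counterclockwise and let `T` be the matching `p₁p₂, p₃p₄, …`, which isolates
`p₀`. Edges of `T` lie on the hull, so they cross nothing. If an odd matching `M` isolates `x ≠ p₀`,
let `y` be the partner of `x` in `T`: replacing the edge of `M` at `y` by `xy` gains an edge of `T`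
and loses none (`exists_flip_of_isolated_ne`).

If `p₀` is isolated and `M ≠ T`, one flip without gain isolates another point
(`exists_flip_of_isolated_eq`), and two gaining flips are then guaranteed. So three flips gain at
least two edges, and `T` has eccentricity at most `3m/2`. This bounds the radius, and twice it
bounds the diameter. -/

/-! ### Counterclockwise labelling of points in convex position -/

/-- The signed area of the parallelogram spanned by `b - a` and `c - a`. -/
def orient (a b c : Plane) : ℝ :=
  (b 0 - a 0) * (c 1 - a 1) - (b 1 - a 1) * (c 0 - a 0)

theorem InConvexPosition.mem_of_mem_convexHull {S : Finset Plane} (hS : InConvexPosition S)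
    {T : Set Plane} (hT : T ⊆ S) {x : Plane} (hx : x ∈ S) (hxT : x ∈ convexHull ℝ T) :
    x ∈ T := by
  have h := hS {y : S | (y : Plane) ∈ T} ⟨x, hx⟩
  refine h ?_
  have : (fun p : S => (p : Plane)) '' {y : S | (y : Plane) ∈ T} = T := by
    ext y
    constructor
    · rintro ⟨z, hz, rfl⟩
      exact hz
    · exact fun hy => ⟨⟨y, hT hy⟩, hy, rfl⟩
  rwa [this]

theorem exists_linear_separation {S : Finset Plane} (hS : InConvexPosition S) {o : Plane}
    (ho : o ∈ S) :
    ∃ α β : ℝ, ∀ a ∈ S, a ≠ o → 0 < α * (a 0 - o 0) + β * (a 1 - o 1) := by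
  have hno : o ∉ convexHull ℝ ((S : Set Plane) \ {o}) := fun h =>
    (hS.mem_of_mem_convexHull Set.sdiff_subset ho h).2 rfl
  obtain ⟨f, u, hfo, hf⟩ := geometric_hahn_banach_point_closed (convex_convexHull ℝ _)
    ((S.finite_toSet.sdiff (t := {o})).isClosed_convexHull ℝ) hno
  have hfx (v : Plane) : f v = ((InnerProductSpace.toDual ℝ Plane).symm f) 0 * v 0
      + ((InnerProductSpace.toDual ℝ Plane).symm f) 1 * v 1 := by
    rw [← InnerProductSpace.toDual_symm_apply (𝕜 := ℝ) (x := v) (y := f),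
      PiLp.inner_apply, Fin.sum_univ_two]
    simp only [RCLike.inner_apply, conj_trivial, mul_comm]
  refine ⟨((InnerProductSpace.toDual ℝ Plane).symm f) 0,
    ((InnerProductSpace.toDual ℝ Plane).symm f) 1, fun a ha hao => ?_⟩
  have h := hfo.trans (hf a (subset_convexHull ℝ _ ⟨ha, hao⟩))
  rw [hfx a, hfx o] at h
  linarith

theorem mem_convexHull_pair_of_orient_eq_zero {o a b : Plane} {α β : ℝ}
    (ha : 0 < α * (a 0 - o 0) + β * (a 1 - o 1)) (hb : 0 < α * (b 0 - o 0) + β * (b 1 - o 1))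
    (hab : α * (a 0 - o 0) + β * (a 1 - o 1) ≤ α * (b 0 - o 0) + β * (b 1 - o 1))
    (h : orient o a b = 0) : a ∈ convexHull ℝ {o, b} := by
  unfold orient at h
  rw [convexHull_pair, segment_eq_image']
  set s := α * (a 0 - o 0) + β * (a 1 - o 1) with hs
  set t := α * (b 0 - o 0) + β * (b 1 - o 1) with ht
  refine ⟨s / t, ⟨by positivity, (div_le_one hb).2 hab⟩, ?_⟩
  ext i
  have h0 : s / t * (b 0 - o 0) = a 0 - o 0 := by
    rw [div_mul_eq_mul_div, div_eq_iff hb.ne', hs, ht]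
    linear_combination -β * h
  have h1 : s / t * (b 1 - o 1) = a 1 - o 1 := by
    rw [div_mul_eq_mul_div, div_eq_iff hb.ne', hs, ht]
    linear_combination α * h
  fin_cases i
  · simp [h0]
  · simp [h1]

/-- The barycentric coordinates of `b` in the triangle `o a c` are ratios of signed areas, all
nonnegative here. -/
theorem mem_convexHull_triple_of_orient {o a b c : Plane} (h₁ : 0 < orient o a b)
    (h₂ : 0 < orient o b c) (h₃ : orient a b c ≤ 0) (h₄ : 0 < orient o a c) :
    b ∈ convexHull ℝ {o, a, c} := by
  have hsum : ∑ i : Fin 3, (![-orient a b c / orient o a c, orient o b c / orient o a c,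
      orient o a b / orient o a c] i) • (![o, a, c] i) = b := by
    ext i
    simp only [Fin.sum_univ_three]
    fin_cases i <;>
    · simp
      field_simp
      unfold orient
      ring
  rw [← hsum]
  refine (convex_convexHull ℝ _).sum_mem ?_ ?_ ?_
  · intro i _
    fin_cases i
    · exact div_nonneg (by simpa using h₃) h₄.le
    · exact div_nonneg h₂.le h₄.le
    · exact div_nonneg h₁.le h₄.le
  · simp only [Fin.sum_univ_three]
    simp
    field_simp
    unfold orient
    ring
  · intro i _
    apply subset_convexHull
    fin_cases i <;> simp

-- Seen from a point `o` of `S`, all other points lie in an open half-plane, so they can be sorted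
-- by the tangent `θ` of their angle to its inner normal `(α, β)`; `o` itself gets `⊥`. A tie in
-- `θ`, or a triple that fails to turn left, would put a point of `S` in the hull of others.
open Classical in
theorem exists_orienting_key {S : Finset Plane} (hS : InConvexPosition S) (hne : S.Nonempty) :
    ∃ key : Plane → WithBot ℝ, Set.InjOn key S ∧ ∀ a ∈ S, ∀ b ∈ S, ∀ c ∈ S,
      key a < key b → key b < key c → 0 < orient a b c := by
  obtain ⟨o, ho⟩ := hne
  obtain ⟨α, β, hpos⟩ := exists_linear_separation hS ho
  let θ : Plane → ℝ := fun a =>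
    (α * (a 1 - o 1) - β * (a 0 - o 0)) / (α * (a 0 - o 0) + β * (a 1 - o 1))
  have hθ : ∀ a b, (0 < α * (a 0 - o 0) + β * (a 1 - o 1)) →
      (0 < α * (b 0 - o 0) + β * (b 1 - o 1)) → θ a < θ b → 0 < orient o a b := by
    intro a b ha hb h
    rw [div_lt_div_iff₀ ha hb] at h
    have : 0 < (α ^ 2 + β ^ 2) * orient o a b := by
      unfold orient
      linarith
    exact pos_of_mul_pos_right this (by positivity)
  have hθ' : ∀ a b, (0 < α * (a 0 - o 0) + β * (a 1 - o 1)) →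
      (0 < α * (b 0 - o 0) + β * (b 1 - o 1)) → θ a = θ b → orient o a b = 0 := by
    intro a b ha hb h
    rw [div_eq_div_iff ha.ne' hb.ne'] at h
    have h0 : (α ^ 2 + β ^ 2) * orient o a b = 0 := by
      unfold orient
      linarith
    rcases mul_eq_zero.1 h0 with h1 | h1
    · exfalso
      have hα : α = 0 := by nlinarith [sq_nonneg α, sq_nonneg β]
      have hβ : β = 0 := by nlinarith [sq_nonneg α, sq_nonneg β]
      simp [hα, hβ] at ha
    · exact h1
  have hinj : Set.InjOn (fun a => if a = o then (⊥ : WithBot ℝ) else (θ a : WithBot ℝ)) S := by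
    have key : ∀ a ∈ S, ∀ b ∈ S, a ≠ o → b ≠ o → θ a = θ b →
        α * (a 0 - o 0) + β * (a 1 - o 1) ≤ α * (b 0 - o 0) + β * (b 1 - o 1) → a = b := by
      intro a ha b hb hao hbo h hle
      have hmem := mem_convexHull_pair_of_orient_eq_zero (hpos a ha hao) (hpos b hb hbo) hle
        (hθ' a b (hpos a ha hao) (hpos b hb hbo) h)
      have := hS.mem_of_mem_convexHull (T := {o, b}) (by
        rintro x (rfl | rfl)
        exacts [ho, hb]) ha hmem
      simpa [hao] using this
    intro a ha b hb h
    by_cases hao : a = o <;> by_cases hbo : b = o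
    · rw [hao, hbo]
    · simp [hao, hbo] at h
    · simp [hao, hbo] at h
    · simp only [hao, hbo, if_false, WithBot.coe_inj] at h
      rcases le_total (α * (a 0 - o 0) + β * (a 1 - o 1))
        (α * (b 0 - o 0) + β * (b 1 - o 1)) with hle | hle
      · exact key a ha b hb hao hbo h hle
      · exact (key b hb a ha hbo hao h.symm hle).symm
  refine ⟨_, hinj, fun a ha b hb c hc hab hbc => ?_⟩
  have hbo : b ≠ o := by
    rintro rfl
    simp at hab
  have hco : c ≠ o := by
    rintro rfl
    simp at hbc
  have hbc' : θ b < θ c := by simpa [hbo, hco] using hbc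
  have h₂ := hθ b c (hpos b hb hbo) (hpos c hc hco) hbc'
  by_cases hao : a = o
  · rwa [hao]
  have hab' : θ a < θ b := by simpa [hbo, hao] using hab
  have h₁ := hθ a b (hpos a ha hao) (hpos b hb hbo) hab'
  have h₄ := hθ a c (hpos a ha hao) (hpos c hc hco) (hab'.trans hbc')
  by_contra h₃
  have hmem := hS.mem_of_mem_convexHull (T := {o, a, c}) (by
    rintro x (rfl | rfl | rfl)
    exacts [ho, ha, hc]) hb (mem_convexHull_triple_of_orient h₁ h₂ (not_lt.1 h₃) h₄)
  rcases hmem with h | h | h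
  · exact hbo h
  · exact absurd (h ▸ hab) (lt_irrefl _)
  · exact absurd (h ▸ hbc) (lt_irrefl _)

/-- `p 0, …, p (n - 1)` lists the points of `S` in counterclockwise order. -/
structure IsConvexLabelling (S : Finset Plane) (n : ℕ) (p : ℕ → Plane) : Prop where
  mem : ∀ i < n, p i ∈ S
  exists_eq : ∀ x ∈ S, ∃ i < n, p i = x
  inj : ∀ i < n, ∀ j < n, p i = p j → i = j
  orient_pos : ∀ i j k, i < j → j < k → k < n → 0 < orient (p i) (p j) (p k)

open Classical in
theorem exists_isConvexLabelling {S : Finset Plane} (hS : InConvexPosition S)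
    (hne : S.Nonempty) : ∃ p, IsConvexLabelling S S.card p := by
  obtain ⟨key, hinj, horient⟩ := exists_orienting_key hS hne
  have hcard : (S.image key).card = S.card := Finset.card_image_of_injOn hinj
  have hex : ∀ i : Fin S.card, ∃ a ∈ S, key a = (S.image key).orderEmbOfFin hcard i := fun i =>
    Finset.mem_image.1 ((S.image key).orderEmbOfFin_mem hcard i)
  choose q hqS hq using hex
  obtain ⟨p, hval⟩ : ∃ p : ℕ → Plane, ∀ i (hi : i < S.card), p i = q ⟨i, hi⟩ :=
    -- The value `0` is never used: every condition on a labelling bounds its indices by `S.card`.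
    ⟨fun i => if h : i < S.card then q ⟨i, h⟩ else 0, fun i hi => dif_pos hi⟩
  refine ⟨p, ⟨?_, ?_, ?_, ?_⟩⟩
  · intro i hi
    rw [hval i hi]
    exact hqS _
  · intro x hx
    have : key x ∈ Set.range ((S.image key).orderEmbOfFin hcard) := by
      rw [Finset.range_orderEmbOfFin]
      exact Finset.mem_coe.2 (Finset.mem_image_of_mem key hx)
    obtain ⟨i, hi⟩ := this
    refine ⟨i, i.2, ?_⟩
    rw [hval i i.2]
    exact hinj (hqS _) hx ((hq _).trans hi)
  · intro i hi j hj h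
    rw [hval i hi, hval j hj] at h
    have := congrArg key h
    rw [hq, hq] at this
    simpa using this
  · intro i j k hij hjk hk
    have hj := hjk.trans hk
    have hi := hij.trans hj
    rw [hval i hi, hval j hj, hval k hk]
    refine horient _ (hqS _) _ (hqS _) _ (hqS _) ?_ ?_
    · rw [hq, hq]
      simpa using hij
    · rw [hq, hq]
      simpa using hjk

/-! ### Non-crossing criteria -/

theorem convex_orient_pos (a b : Plane) : Convex ℝ {z : Plane | 0 < orient a b z} := by
  intro x hx y hy s t hs ht hst
  have h : orient a b (s • x + t • y) = s * orient a b x + t * orient a b y := by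
    obtain rfl : t = 1 - s := by linarith
    simp [orient]
    ring
  rw [Set.mem_ofPred_eq] at hx hy ⊢
  rw [h]
  rcases hs.eq_or_lt with rfl | hs
  · have : t = 1 := by linarith
    simpa [this] using hy
  · have := mul_pos hs hx
    have := mul_nonneg ht hy.le
    linarith

theorem convex_orient_neg (a b : Plane) : Convex ℝ {z : Plane | orient a b z < 0} := by
  have h : {z : Plane | orient a b z < 0} = {z : Plane | 0 < orient b a z} := by
    ext z
    have : orient b a z = -orient a b z := by
      unfold orient
      ring
    simp [this]
  rw [h]
  exact convex_orient_pos b a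

theorem orient_eq_zero_of_mem_edgeSegment {a b z : Plane} (h : z ∈ edgeSegment s(a, b)) :
    orient a b z = 0 := by
  have hset : {p : Plane | p ∈ s(a, b)} = {a, b} := by
    ext
    simp
  rw [edgeSegment, hset, convexHull_pair, segment_eq_image'] at h
  obtain ⟨t, _, rfl⟩ := h
  simp [orient]
  ring

theorem disjoint_edgeSegment_of_orient_pos {a b : Plane} {e : Sym2 Plane}
    (h : ∀ x ∈ e, 0 < orient a b x) : Disjoint (edgeSegment s(a, b)) (edgeSegment e) := by
  rw [Set.disjoint_left]
  intro z hz hze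
  have h1 : 0 < orient a b z := convexHull_min h (convex_orient_pos a b) hze
  exact h1.ne' (orient_eq_zero_of_mem_edgeSegment hz)

theorem disjoint_edgeSegment_of_orient_neg {a b : Plane} {e : Sym2 Plane}
    (h : ∀ x ∈ e, orient a b x < 0) : Disjoint (edgeSegment s(a, b)) (edgeSegment e) := by
  rw [Set.disjoint_left]
  intro z hz hze
  have h1 : orient a b z < 0 := convexHull_min h (convex_orient_neg a b) hze
  exact h1.ne (orient_eq_zero_of_mem_edgeSegment hz)

namespace IsConvexLabelling

variable {S : Finset Plane} {n : ℕ} {p : ℕ → Plane}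

/-- Labels outside `[i, j]` lie strictly left of the line from `p i` to `p j`; those strictly
between lie strictly right. -/
theorem disjoint_of_outside (hp : IsConvexLabelling S n p) {i j : ℕ} (hij : i < j) (hj : j < n)
    {e : Sym2 Plane} (he : ∀ x ∈ e, ∃ k < n, p k = x ∧ (k < i ∨ j < k)) :
    Disjoint (edgeSegment s(p i, p j)) (edgeSegment e) := by
  refine disjoint_edgeSegment_of_orient_pos fun x hx => ?_
  obtain ⟨k, hk, rfl, h | h⟩ := he x hx
  · have h1 := hp.orient_pos k i j h hij hj
    have h2 : orient (p i) (p j) (p k) = orient (p k) (p i) (p j) := by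
      unfold orient
      ring
    rwa [h2]
  · exact hp.orient_pos i j k hij h hk

theorem disjoint_of_inside (hp : IsConvexLabelling S n p) {i j : ℕ} (hj : j < n)
    {e : Sym2 Plane} (he : ∀ x ∈ e, ∃ k < n, p k = x ∧ i < k ∧ k < j) :
    Disjoint (edgeSegment s(p i, p j)) (edgeSegment e) := by
  refine disjoint_edgeSegment_of_orient_neg fun x hx => ?_
  obtain ⟨k, _, rfl, h, h'⟩ := he x hx
  have h1 := hp.orient_pos i k j h h' hj
  have h2 : orient (p i) (p j) (p k) = -orient (p i) (p k) (p j) := by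
    unfold orient
    ring
  linarith

end IsConvexLabelling

/-! ### Flips at the isolated point -/

/-- `x` is a point of `S` that is not covered by `M`. -/
def IsIsolated (S : Finset Plane) (M : Set (Sym2 Plane)) (x : Plane) : Prop :=
  x ∈ S ∧ ∀ e ∈ M, x ∉ e

theorem IsPointMatching.eq_of_mem {S : Finset Plane} {M : Set (Sym2 Plane)}
    (hM : IsPointMatching S M) {e f : Sym2 Plane} (he : e ∈ M) (hf : f ∈ M) {x : Plane}
    (hxe : x ∈ e) (hxf : x ∈ f) : e = f := by
  by_contra h
  exact hM.disjoint_endpoints e he f hf h x hxe hxf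

namespace IsOddMatching

variable {S : Finset Plane} {M : Set (Sym2 Plane)}

theorem exists_edge (hM : IsOddMatching S M) {x y : Plane} (hx : IsIsolated S M x) (hy : y ∈ S)
    (hyx : y ≠ x) : ∃ z, s(y, z) ∈ M := by
  by_contra! h
  refine hyx (hM.isolated.unique ⟨hy, fun e he hye => ?_⟩ hx)
  obtain ⟨z, rfl⟩ := hye
  exact h z he

theorem flip (hM : IsOddMatching S M) {x y z : Plane} (hx : IsIsolated S M x)
    (hyz : s(y, z) ∈ M)
    (hd : ∀ f ∈ M, f ≠ s(y, z) → Disjoint (edgeSegment s(x, y)) (edgeSegment f)) :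
    IsOddMatching S (insert s(x, y) (M \ {s(y, z)})) ∧
      IsIsolated S (insert s(x, y) (M \ {s(y, z)})) z ∧
      IsFlip M (insert s(x, y) (M \ {s(y, z)})) := by
  have hxyz : x ∉ s(y, z) := hx.2 _ hyz
  have hxy : x ≠ y := fun h => hxyz (by simp [h])
  have hxz : x ≠ z := fun h => hxyz (by simp [h])
  have hy : ∀ f ∈ M, f ≠ s(y, z) → y ∉ f := fun f hf hne =>
    hM.matching.disjoint_endpoints _ hyz f hf hne.symm y (by simp)
  have hz : ∀ f ∈ M, f ≠ s(y, z) → z ∉ f := fun f hf hne =>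
    hM.matching.disjoint_endpoints _ hyz f hf hne.symm z (by simp)
  have hyzne : y ≠ z := fun h => hM.matching.not_isDiag _ hyz (by simp [h])
  have hiso : IsIsolated S (insert s(x, y) (M \ {s(y, z)})) z := by
    refine ⟨hM.matching.mem_of_mem _ hyz z (by simp), ?_⟩
    rintro e (rfl | ⟨he, hne⟩)
    · simp [hxz.symm, hyzne.symm]
    · exact hz e he hne
  have hdis : ∀ f ∈ M, f ≠ s(y, z) → ∀ w ∈ s(x, y), w ∉ f := by
    intro f hf hne w hw
    rcases Sym2.mem_iff.1 hw with rfl | rfl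
    · exact hx.2 f hf
    · exact hy f hf hne
  refine ⟨⟨⟨?_, ?_, ?_⟩, ?_, z, hiso, ?_⟩, hiso, s(y, z), hyz, s(x, y), ?_, rfl⟩
  · rintro e (rfl | ⟨he, -⟩)
    · simpa using hxy
    · exact hM.matching.not_isDiag e he
  · rintro e (rfl | ⟨he, -⟩) w hw
    · rcases Sym2.mem_iff.1 hw with rfl | rfl
      · exact hx.1
      · exact hM.matching.mem_of_mem _ hyz w (by simp)
    · exact hM.matching.mem_of_mem e he w hw
  · rintro e (rfl | ⟨he, hne⟩) f (rfl | ⟨hf, hnf⟩) hef w hwe hwf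
    · exact hef rfl
    · exact hdis f hf hnf w hwe hwf
    · exact hdis e he hne w hwf hwe
    · exact hM.matching.disjoint_endpoints e he f hf hef w hwe hwf
  · rintro e (rfl | ⟨he, hne⟩) f (rfl | ⟨hf, hnf⟩) hef
    · exact absurd rfl hef
    · exact hd f hf hnf
    · exact (hd e he hne).symm
    · exact hM.plane e he f hf hef
  · rintro w ⟨hwS, hw⟩
    by_contra hwz
    have hwxy := hw _ (Set.mem_insert _ _)
    refine hwxy ?_
    have : w = x := by
      refine hM.isolated.unique ⟨hwS, fun e he hwe => ?_⟩ hx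
      by_cases h : e = s(y, z)
      · subst h
        rcases Sym2.mem_iff.1 hwe with rfl | rfl
        · exact hwxy (by simp)
        · exact hwz rfl
      · exact hw e (Or.inr ⟨he, h⟩) hwe
    simp [this]
  · exact fun h => hx.2 _ h (by simp)

end IsOddMatching

/-! ### The hull matching -/

/-- The matching `p₁p₂, p₃p₄, …` of `m` boundary edges, which leaves `p₀` isolated. -/
def hullMatching (p : ℕ → Plane) (m : ℕ) : Set (Sym2 Plane) :=
  (fun j => s(p (2 * j + 1), p (2 * j + 2))) '' Set.Iio m

theorem hullMatching_finite (p : ℕ → Plane) (m : ℕ) : (hullMatching p m).Finite :=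
  (Set.finite_Iio m).image _

theorem ncard_hullMatching_le (p : ℕ → Plane) (m : ℕ) : (hullMatching p m).ncard ≤ m := by
  simpa [hullMatching] using Set.ncard_image_le (f := fun j => s(p (2 * j + 1), p (2 * j + 2)))
    (Set.finite_Iio m)

namespace IsConvexLabelling

variable {S : Finset Plane} {m : ℕ} {p : ℕ → Plane}

/-- No label lies between `2j + 1` and `2j + 2`, so all other points are on one side of the edge. -/
theorem disjoint_hullMatching (hp : IsConvexLabelling S (2 * m + 1) p) {e f : Sym2 Plane}
    (he : e ∈ hullMatching p m) (hf : ∀ x ∈ f, x ∈ S) (hef : ∀ x ∈ e, x ∉ f) :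
    Disjoint (edgeSegment e) (edgeSegment f) := by
  obtain ⟨j, hj, rfl⟩ := he
  rw [Set.mem_Iio] at hj
  refine hp.disjoint_of_outside (by omega) (by omega) fun x hx => ?_
  obtain ⟨k, hk, rfl⟩ := hp.exists_eq x (hf x hx)
  refine ⟨k, hk, rfl, ?_⟩
  have h1 : k ≠ 2 * j + 1 := fun h => hef (p k) (by simp [h]) hx
  have h2 : k ≠ 2 * j + 2 := fun h => hef (p k) (by simp [h]) hx
  omega

theorem isIsolated_hullMatching (hp : IsConvexLabelling S (2 * m + 1) p) :
    IsIsolated S (hullMatching p m) (p 0) := by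
  refine ⟨hp.mem 0 (by omega), ?_⟩
  rintro _ ⟨j, hj, rfl⟩ h
  rw [Set.mem_Iio] at hj
  rcases Sym2.mem_iff.1 h with h | h
  · have := hp.inj _ (by omega) _ (by omega) h
    omega
  · have := hp.inj _ (by omega) _ (by omega) h
    omega

theorem exists_hullMatching_partner (hp : IsConvexLabelling S (2 * m + 1) p) {x : Plane}
    (hx : x ∈ S) (hx0 : x ≠ p 0) : ∃ y, s(x, y) ∈ hullMatching p m := by
  obtain ⟨k, hk, rfl⟩ := hp.exists_eq x hx
  have hk0 : k ≠ 0 := fun h => hx0 (h ▸ rfl)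
  obtain ⟨j, rfl | rfl⟩ : ∃ j, k = 2 * j + 1 ∨ k = 2 * j + 2 := ⟨(k - 1) / 2, by omega⟩
  · exact ⟨p (2 * j + 2), j, by rw [Set.mem_Iio]; omega, rfl⟩
  · exact ⟨p (2 * j + 1), j, by rw [Set.mem_Iio]; omega, Sym2.eq_swap⟩

theorem isPointMatching_hullMatching (hp : IsConvexLabelling S (2 * m + 1) p) :
    IsPointMatching S (hullMatching p m) := by
  refine ⟨?_, ?_, ?_⟩
  · rintro _ ⟨j, hj, rfl⟩ h
    rw [Set.mem_Iio] at hj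
    have := hp.inj _ (by omega) _ (by omega) (Sym2.mk_isDiag_iff.1 h)
    omega
  · rintro _ ⟨j, hj, rfl⟩ x hx
    rw [Set.mem_Iio] at hj
    rcases Sym2.mem_iff.1 hx with rfl | rfl <;> exact hp.mem _ (by omega)
  · rintro _ ⟨j, hj, rfl⟩ _ ⟨l, hl, rfl⟩ hne x hx hx'
    rw [Set.mem_Iio] at hj hl
    have hjl : j ≠ l := fun h => hne (h ▸ rfl)
    rcases Sym2.mem_iff.1 hx with rfl | rfl <;> rcases Sym2.mem_iff.1 hx' with h | h <;>
    · have := hp.inj _ (by omega) _ (by omega) h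
      omega

theorem isOddMatching_hullMatching (hp : IsConvexLabelling S (2 * m + 1) p) :
    IsOddMatching S (hullMatching p m) where
  matching := hp.isPointMatching_hullMatching
  plane e he f hf hef := hp.disjoint_hullMatching he
    (hp.isPointMatching_hullMatching.mem_of_mem f hf)
    (hp.isPointMatching_hullMatching.disjoint_endpoints e he f hf hef)
  isolated := by
    refine ⟨p 0, hp.isIsolated_hullMatching, fun x hx => ?_⟩
    by_contra h
    obtain ⟨y, hy⟩ := hp.exists_hullMatching_partner hx.1 h
    exact hx.2 _ hy (by simp)

/-- The hull matching as a vertex of the flip graph. -/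
def hullOddMatching (hp : IsConvexLabelling S (2 * m + 1) p) : OddMatching S :=
  ⟨hullMatching p m, hp.isOddMatching_hullMatching⟩

/-- Every edge of `M` has an endpoint other than `p 0`, where it must agree with the hull edge. -/
theorem eq_hullMatching_of_subset (hp : IsConvexLabelling S (2 * m + 1) p)
    {M : Set (Sym2 Plane)} (hM : IsPointMatching S M) (h : hullMatching p m ⊆ M) :
    M = hullMatching p m := by
  refine Set.Subset.antisymm (fun e he => ?_) h
  have hex : ∃ x ∈ e, x ≠ p 0 := by
    induction e with | _ a b =>
    by_cases ha : a = p 0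
    · refine ⟨b, by simp, fun hb => hM.not_isDiag _ he ?_⟩
      simp [ha, hb]
    · exact ⟨a, by simp, ha⟩
  obtain ⟨x, hxe, hx0⟩ := hex
  obtain ⟨y, hy⟩ := hp.exists_hullMatching_partner (hM.mem_of_mem e he x hxe) hx0
  rwa [hM.eq_of_mem he (h hy) hxe (by simp)]

/-! ### Flipping towards the hull matching -/

/-- If the isolated point is not `p 0`, then one flip inserts a further edge of the hull
matching and removes none. -/
theorem exists_flip_of_isolated_ne (hp : IsConvexLabelling S (2 * m + 1) p) (M : OddMatching S)
    {x : Plane} (hx : IsIsolated S M.1 x) (hx0 : x ≠ p 0) :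
    ∃ (M' : OddMatching S) (y z : Plane), (flipGraph S).Adj M M' ∧ s(x, y) ∈ hullMatching p m ∧
      s(y, z) ∈ M.1 ∧ IsIsolated S M'.1 z ∧
      (hullMatching p m \ M'.1).ncard + 1 = (hullMatching p m \ M.1).ncard := by
  obtain ⟨y, hxy⟩ := hp.exists_hullMatching_partner hx.1 hx0
  have hT := hp.isPointMatching_hullMatching
  have hyx : y ≠ x := fun h => hT.not_isDiag _ hxy (by simp [h])
  obtain ⟨z, hyz⟩ := M.2.exists_edge hx (hT.mem_of_mem _ hxy y (by simp)) hyx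
  have hxyM : s(x, y) ∉ M.1 := fun h => hx.2 _ h (by simp)
  obtain ⟨hodd, hiso, hflip⟩ := M.2.flip hx hyz fun f hf hne => by
    refine hp.disjoint_hullMatching hxy (M.2.matching.mem_of_mem f hf) fun w hw => ?_
    rcases Sym2.mem_iff.1 hw with rfl | rfl
    · exact hx.2 f hf
    · exact M.2.matching.disjoint_endpoints _ hyz f hf hne.symm w (by simp)
  refine ⟨⟨_, hodd⟩, y, z, hflip, hxy, hyz, hiso, ?_⟩
  -- The hull edge at `y` is `xy`, which `M` lacks, so the removed edge is not a hull edge.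
  have hyzT : s(y, z) ∉ hullMatching p m := fun h =>
    hxyM (hT.eq_of_mem hxy h (x := y) (by simp) (by simp) ▸ hyz)
  have hset : hullMatching p m \ insert s(x, y) (M.1 \ {s(y, z)})
      = (hullMatching p m \ M.1) \ {s(x, y)} := by
    ext e
    have : e ∈ hullMatching p m → e ≠ s(y, z) := fun h h' => hyzT (h' ▸ h)
    simp only [Set.mem_sdiff, Set.mem_insert_iff, Set.mem_singleton_iff]
    tauto
  rw [hset]
  exact Set.ncard_sdiff_singleton_add_one ⟨hxy, hxyM⟩ ((hullMatching_finite p m).sdiff)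

/-- If `p 0` is isolated and the hull matching is not reached, then some flip removes no edge of
the hull matching and isolates a point other than `p 0`. -/
theorem exists_flip_of_isolated_eq (hp : IsConvexLabelling S (2 * m + 1) p) (M : OddMatching S)
    (h0 : IsIsolated S M.1 (p 0)) (hne : ¬ hullMatching p m ⊆ M.1) :
    ∃ (M' : OddMatching S) (a b : Plane), (flipGraph S).Adj M M' ∧ s(a, b) ∉ hullMatching p m ∧
      s(p 0, a) ∈ M'.1 ∧ IsIsolated S M'.1 b ∧ b ≠ p 0 ∧
      hullMatching p m \ M'.1 = hullMatching p m \ M.1 := by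
  classical
  have hex : ∃ j, j < m ∧ s(p (2 * j + 1), p (2 * j + 2)) ∉ M.1 := by
    by_contra! h
    refine hne ?_
    rintro _ ⟨j, hj, rfl⟩
    exact h j hj
  -- With `j` minimal, the points strictly between `p 0` and `p (2j + 1)` are matched among
  -- themselves, so the segment joining these two crosses no other edge.
  obtain ⟨j, ⟨hj, hjM⟩, hmin⟩ : ∃ j, (j < m ∧ s(p (2 * j + 1), p (2 * j + 2)) ∉ M.1) ∧
      ∀ l < j, s(p (2 * l + 1), p (2 * l + 2)) ∈ M.1 := by
    refine ⟨Nat.find hex, Nat.find_spec hex, fun l hl => ?_⟩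
    by_contra h
    exact Nat.find_min hex hl ⟨hl.trans (Nat.find_spec hex).1, h⟩
  have hT := hp.isPointMatching_hullMatching
  have hjT : s(p (2 * j + 1), p (2 * j + 2)) ∈ hullMatching p m := ⟨j, hj, rfl⟩
  have ha0 : p (2 * j + 1) ≠ p 0 := fun h => by
    have := hp.inj _ (by omega) _ (by omega) h
    omega
  obtain ⟨b, hab⟩ := M.2.exists_edge h0 (hp.mem (2 * j + 1) (by omega)) ha0
  obtain ⟨hodd, hiso, hflip⟩ := M.2.flip h0 hab fun f hf hfne => by
    have hf0 : p 0 ∉ f := h0.2 f hf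
    have hfa : p (2 * j + 1) ∉ f :=
      M.2.matching.disjoint_endpoints _ hab f hf hfne.symm _ (by simp)
    by_cases hin : ∃ k < 2 * j + 1, p k ∈ f
    · obtain ⟨k, hk, hkf⟩ := hin
      have hk0 : k ≠ 0 := fun h => hf0 (h ▸ hkf)
      obtain ⟨l, hl, hkl⟩ : ∃ l < j, k = 2 * l + 1 ∨ k = 2 * l + 2 :=
        ⟨(k - 1) / 2, by omega, by omega⟩
      have hfl : f = s(p (2 * l + 1), p (2 * l + 2)) := by
        refine M.2.matching.eq_of_mem hf (hmin l hl) hkf ?_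
        rcases hkl with rfl | rfl <;> simp
      refine hp.disjoint_of_inside (by omega) fun x hx => ?_
      rw [hfl] at hx
      rcases Sym2.mem_iff.1 hx with rfl | rfl
      · exact ⟨2 * l + 1, by omega, rfl, by omega, by omega⟩
      · exact ⟨2 * l + 2, by omega, rfl, by omega, by omega⟩
    · push Not at hin
      refine hp.disjoint_of_outside (by omega) (by omega) fun x hx => ?_
      obtain ⟨k, hk, rfl⟩ := hp.exists_eq x (M.2.matching.mem_of_mem f hf x hx)
      refine ⟨k, hk, rfl, Or.inr ?_⟩
      have h1 : k ≠ 2 * j + 1 := fun h => hfa (h ▸ hx)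
      have h2 : ¬ k < 2 * j + 1 := fun h => hin k h hx
      omega
  have habT : s(p (2 * j + 1), b) ∉ hullMatching p m := fun h =>
    hjM (hT.eq_of_mem hjT h (x := p (2 * j + 1)) (by simp) (by simp) ▸ hab)
  refine ⟨⟨_, hodd⟩, p (2 * j + 1), b, hflip, habT, Set.mem_insert _ _, hiso, ?_, ?_⟩
  · rintro rfl
    exact h0.2 _ hab (by simp)
  · ext e
    have h1 : e ∈ hullMatching p m → e ≠ s(p (2 * j + 1), b) := fun h h' => habT (h' ▸ h)
    have h2 : e ∈ hullMatching p m → e ≠ s(p 0, p (2 * j + 1)) := fun h h' =>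
      hp.isIsolated_hullMatching.2 e h (by simp [h'])
    simp only [Set.mem_sdiff, Set.mem_insert_iff, Set.mem_singleton_iff]
    tauto

/-- Strong induction on the number of missing hull edges: one flip gains one, or three flips gain
two. -/
theorem exists_walk_to_hullMatching (hp : IsConvexLabelling S (2 * m + 1) p) (k : ℕ) :
    ∀ M : OddMatching S, (hullMatching p m \ M.1).ncard = k →
      ∃ w : (flipGraph S).Walk M hp.hullOddMatching,
        2 * w.length ≤ 3 * k := by
  induction k using Nat.strong_induction_on with | _ k ih =>
  intro M hk
  obtain ⟨x, hx, -⟩ := M.2.isolated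
  by_cases hx0 : x = p 0
  · subst hx0
    by_cases hsub : hullMatching p m ⊆ M.1
    · obtain rfl : M = hp.hullOddMatching :=
        Subtype.ext (hp.eq_hullMatching_of_subset M.2.matching hsub)
      exact ⟨.nil, by simp⟩
    · obtain ⟨M₁, a, b, hadj₁, habT, h0a, hb, hb0, heq⟩ :=
        hp.exists_flip_of_isolated_eq M hx hsub
      obtain ⟨M₂, y, z, hadj₂, hby, hyz, hz, hcard₂⟩ := hp.exists_flip_of_isolated_ne M₁ hb hb0
      -- If `z = p 0`, then `yz` is the edge from `p 0` to `a`, so `y = a` and the hull edge `by` is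
      -- `ab`, which is not in the hull matching.
      have hz0 : z ≠ p 0 := by
        rintro rfl
        have h := M₁.2.matching.eq_of_mem hyz h0a (x := p 0) (by simp) (by simp)
        rw [Sym2.eq_swap, Sym2.congr_right] at h
        exact habT (by rwa [← h, Sym2.eq_swap])
      obtain ⟨M₃, -, -, hadj₃, -, -, -, hcard₃⟩ := hp.exists_flip_of_isolated_ne M₂ hz hz0
      rw [heq] at hcard₂
      obtain ⟨w, hw⟩ := ih _ (by omega) M₃ rfl
      refine ⟨.cons hadj₁ (.cons hadj₂ (.cons hadj₃ w)), ?_⟩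
      simp only [SimpleGraph.Walk.length_cons]
      omega
  · obtain ⟨M₁, -, -, hadj, -, -, -, hcard⟩ := hp.exists_flip_of_isolated_ne M hx hx0
    obtain ⟨w, hw⟩ := ih _ (by omega) M₁ rfl
    refine ⟨.cons hadj w, ?_⟩
    simp only [SimpleGraph.Walk.length_cons]
    omega

theorem eccent_hullMatching_le (hp : IsConvexLabelling S (2 * m + 1) p) :
    (flipGraph S).eccent hp.hullOddMatching
      ≤ ((3 * m / 2 : ℕ) : ℕ∞) := by
  rw [SimpleGraph.eccent_le_iff]
  intro M
  obtain ⟨w, hw⟩ := hp.exists_walk_to_hullMatching _ M rfl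
  have hcard : (hullMatching p m \ M.1).ncard ≤ m :=
    (Set.ncard_le_ncard Set.sdiff_subset (hullMatching_finite p m)).trans
      (ncard_hullMatching_le p m)
  rw [SimpleGraph.edist_comm]
  refine w.edist_le.trans ?_
  exact_mod_cast (by omega : w.length ≤ 3 * m / 2)

end IsConvexLabelling

theorem mainTheorem7 (m n : ℕ) (hn : n = 2 * m + 1) (S : Finset Plane) (hcard : S.card = n)
    (hconv : InConvexPosition S) :
    ∃ r d : ℕ, (flipGraph S).radius = (r : ℕ∞) ∧ (flipGraph S).ediam = (d : ℕ∞) ∧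
      (r : ℝ) ≤ 3 * (m : ℝ) / 2 ∧
      (d : ℝ) ≤ 3 * (m : ℝ) ∧ (d : ℝ) ≤ 3 * (n : ℝ) / 2 - 3 / 2 := by
  obtain ⟨p, hp⟩ := exists_isConvexLabelling hconv (Finset.card_pos.1 (by omega))
  rw [hcard, hn] at hp
  have hecc := hp.eccent_hullMatching_le
  have hrad := SimpleGraph.radius_le_eccent.trans hecc
  have hdiam : (flipGraph S).ediam ≤ ((2 * (3 * m / 2) : ℕ) : ℕ∞) := by
    refine (SimpleGraph.ediam_le_two_mul_eccent _).trans ((mul_le_mul_right hecc 2).trans ?_)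
    push_cast
    exact le_rfl
  obtain ⟨r, hr⟩ := ENat.ne_top_iff_exists.1 (ne_top_of_le_ne_top (ENat.natCast_ne_top _) hrad)
  obtain ⟨d, hd⟩ := ENat.ne_top_iff_exists.1 (ne_top_of_le_ne_top (ENat.natCast_ne_top _) hdiam)
  rw [← hr, Nat.cast_le] at hrad
  rw [← hd, Nat.cast_le] at hdiam
  have hr' : (2 * r : ℝ) ≤ 3 * m := by exact_mod_cast (by omega : 2 * r ≤ 3 * m)
  have hd' : (d : ℝ) ≤ 3 * m := by exact_mod_cast (by omega : d ≤ 3 * m)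
  refine ⟨r, d, hr.symm, hd.symm, by linarith, hd', ?_⟩
  rw [hn]
  push_cast
  linarith
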